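/- Call a polynomial $f\in\mathbb{C}[z_1,\ldots,z_m]$ stable if $f(z_1,\ldots,z_m)\neq 0$ for all $(z_1,\ldots,z_m)\in\mathbb{C}^m$ with $\operatorname{Im}(z_j)>0$ for every $j$ (so the zero polynomial is not stable), and let $\mathcal{H}_m(\mathbb{C})$ be the set of stable polynomials in $m$ variables. A linear operator $T:\mathbb{C}[z]\to\mathbb{C}[z]$ preserves stability if $T(\mathcal{H}_1(\mathbb{C}))\subseteq\mathcal{H}_1(\mathbb{C})\cup\{0\}$. Extend $T$ linearly to $\mathbb{C}[z,w]$ by $T(z^kw^\ell)=T(z^k)w^\ell$ for all integers $k,\ell\ge 0$. Let $T:\mathbb{C}[z]\to\mathbb{C}[z]$ be a linear operator. Then $T$ preserves stability if and only if at least one of the following holds: (a) $T$ has range of dimension at most one and is of the form $T(f)=\alpha(f)P$, $f\in\mathbb{C}[z]$, where $\alpha:\mathbb{C}[z]\to\mathbb{C}$ is a linear functional and $P\in\mathcal{H}_1(\mathbb{C})$; (b) $T[(z+w)^n]\in\mathcal{H}_2(\mathbb{C})\cup\{0\}$ for all integers $n\ge 0$. -/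

import Mathlib

noncomputable section

namespace StabilityPreservers

/-- `stablePolys n` is the set of stable polynomials in `n` complex variables: those without
zeros in the `n`-fold product of the open upper half-plane. -/
def stablePolys (n : ℕ) : Set (MvPolynomial (Fin n) ℂ) :=
  {f | ∀ z : Fin n → ℂ, (∀ j, 0 < (z j).im) → MvPolynomial.eval z f ≠ 0}

/-- The set of stable univariate polynomials, inside `ℂ[z]`. -/
def stableUnivariate : Set (Polynomial ℂ) :=
  {f | ∀ z : ℂ, 0 < z.im → f.eval z ≠ 0}

/-- The two notions of stability agree for one variable. -/
theorem mem_stableUnivariate_iff (f : Polynomial ℂ) :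
    f ∈ stableUnivariate ↔
      Polynomial.aeval (MvPolynomial.X (0 : Fin 1)) f ∈ stablePolys 1 := by
  have key : ∀ z : Fin 1 → ℂ, MvPolynomial.eval z
      (Polynomial.aeval (MvPolynomial.X (0 : Fin 1)) f) = f.eval (z 0) := by
    intro z
    rw [← MvPolynomial.coe_aeval_eq_eval, RingHom.coe_coe, ← Polynomial.aeval_algHom_apply]
    simp
  constructor
  · intro h z hz
    rw [key]
    exact h _ (hz 0)
  · intro h z hz
    have := h (fun _ => z) (fun _ => hz)
    rwa [key] at this

/-- `T` preserves stability on all of `ℂ[z]`: it maps each stable polynomial to a stable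
polynomial or to `0`. -/
def PreservesStability (T : Polynomial ℂ →ₗ[ℂ] Polynomial ℂ) : Prop :=
  T '' stableUnivariate ⊆ stableUnivariate ∪ {0}

/-- The extension of a linear operator `T` on `ℂ[z]` to `ℂ[z, w]`, where `z` and `w` are the
variables `0` and `1`: the linear operator with `z ^ k * w ^ l ↦ T (z ^ k) * w ^ l`. -/
def extendBivariate (T : Polynomial ℂ →ₗ[ℂ] Polynomial ℂ) :
    MvPolynomial (Fin 2) ℂ →ₗ[ℂ] MvPolynomial (Fin 2) ℂ :=
  (MvPolynomial.basisMonomials (Fin 2) ℂ).constr ℂ fun m =>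
    Polynomial.aeval (MvPolynomial.X (0 : Fin 2)) (T (Polynomial.X ^ m 0)) *
      MvPolynomial.X (1 : Fin 2) ^ m 1

theorem extendBivariate_apply (T : Polynomial ℂ →ₗ[ℂ] Polynomial ℂ) (k l : ℕ) :
    extendBivariate T (MvPolynomial.X 0 ^ k * MvPolynomial.X 1 ^ l) =
      Polynomial.aeval (MvPolynomial.X (0 : Fin 2)) (T (Polynomial.X ^ k)) *
        MvPolynomial.X (1 : Fin 2) ^ l := by
  have h : (MvPolynomial.X 0 ^ k * MvPolynomial.X 1 ^ l : MvPolynomial (Fin 2) ℂ) =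
      MvPolynomial.basisMonomials (Fin 2) ℂ (Finsupp.single 0 k + Finsupp.single 1 l) := by
    simp [MvPolynomial.X_pow_eq_monomial, MvPolynomial.monomial_mul]
  rw [h, extendBivariate, Module.Basis.constr_basis]
  simp

end StabilityPreservers

end

noncomputable section

namespace StabilityPreservers

open Polynomial Filter Topology

/-! ### Stable univariate polynomials -/

/-! If the symbols are stable or zero, fix `z` in the upper half-plane and consider the functional
`f ↦ T f (z)`. Laguerre's theorem trades the factors of `(X + w) ^ n` one by one for arbitrary `X +
wᵢ` (Grace, `functional_prod_ne_zero`); Hurwitz then reaches roots on the real axis. A vanishing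
symbol kills all degrees up to `n`.

Conversely, let `T` preserve stability and let the `n`-th symbol be neither stable nor zero.
Differentiation in `w` passes a good symbol down one degree (`symbol_descend`), so for every `N ≥ n`
some `(X + w) ^ N` with `w` in the upper half-plane is killed. Any `f` of degree at most `N` is a
perturbation of that power, so every `T f` is stable or zero, and such a range has dimension at most
one. -/

theorem im_root_nonpos {p : ℂ[X]} (hp : p ∈ stableUnivariate) {r : ℂ} (hr : r ∈ p.roots) :
    r.im ≤ 0 := by
  by_contra! h
  exact hp r h (isRoot_of_mem_roots hr)

/-- Inversion about a point of height `y` maps the half-plane `y ≤ im` to a disc. -/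
theorem norm_inv_add_le_iff {a : ℂ} (ha : a ≠ 0) {y : ℝ} (hy : 0 < y) :
    ‖1 / a + Complex.I / (2 * y)‖ ≤ 1 / (2 * y) ↔ y ≤ a.im := by
  have hy' : (y : ℂ) ≠ 0 := by exact_mod_cast hy.ne'
  have h1 : 1 / a + Complex.I / (2 * y) = (2 * y + Complex.I * a) / (2 * y * a) := by
    field_simp
  have h2 : ‖(2 * y * a : ℂ)‖ = 2 * y * ‖a‖ := by
    simp [abs_of_pos hy]
  have hna : 0 < ‖a‖ := norm_pos_iff.mpr ha
  rw [h1, norm_div, h2, div_le_div_iff₀ (by positivity) (by positivity), one_mul,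
    mul_comm (2 * y) ‖a‖, mul_le_mul_iff_left₀ (by positivity),
    ← sq_le_sq₀ (norm_nonneg _) hna.le, Complex.sq_norm, Complex.sq_norm,
    Complex.normSq_apply, Complex.normSq_apply]
  simp only [Complex.add_re, Complex.add_im, Complex.mul_re, Complex.mul_im, Complex.I_re,
    Complex.I_im, Complex.ofReal_re, Complex.ofReal_im, Complex.re_ofNat, Complex.im_ofNat]
  constructor
  · intro h
    by_contra! hlt
    nlinarith [mul_pos hy (sub_pos.mpr hlt)]
  · intro h
    nlinarith [mul_nonneg hy.le (sub_nonneg.mpr h)]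

theorem norm_multiset_sum_add_le {s : Multiset ℂ} {c : ℂ} {R : ℝ}
    (h : ∀ u ∈ s, ‖u + c‖ ≤ R) : ‖s.sum + s.card * c‖ ≤ s.card * R := by
  induction s using Multiset.induction_on with
  | empty => simp
  | cons a s ih =>
    rw [Multiset.sum_cons, Multiset.card_cons]
    push_cast
    have h1 := ih fun u hu => h u (Multiset.mem_cons_of_mem hu)
    have h2 := h a (Multiset.mem_cons_self a s)
    calc ‖a + s.sum + ((s.card : ℂ) + 1) * c‖ = ‖(s.sum + s.card * c) + (a + c)‖ := by
          congr 1; ring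
      _ ≤ _ := norm_add_le _ _
      _ ≤ _ := by linarith

/-- Laguerre's theorem for the upper half-plane: polar derivatives of a stable polynomial with
respect to a point of the upper half-plane do not vanish there. -/
theorem polar_derivative_ne_zero {p : ℂ[X]} (hp : p ∈ stableUnivariate) {n : ℕ}
    (hdeg : p.natDegree ≤ n) (hn : 0 < n) {v w : ℂ} (hv : 0 < v.im) (hw : 0 < w.im) :
    n * p.eval w + (v - w) * p.derivative.eval w ≠ 0 := by
  intro h0
  have hpw : p.eval w ≠ 0 := hp w hw
  have hnC : (n : ℂ) ≠ 0 := by exact_mod_cast hn.ne'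
  have hwv : w - v ≠ 0 := by
    intro h
    have : v - w = 0 := by linear_combination -h
    rw [this, zero_mul, add_zero] at h0
    exact mul_ne_zero hnC hpw h0
  -- Inversion sends the half-plane at height `w.im` or above to the disc of centre `-c` and radius
  -- `R`.
  set c : ℂ := Complex.I / (2 * w.im)
  set R : ℝ := 1 / (2 * w.im)
  have hc : ‖c‖ = R := by simp [c, R, abs_of_pos hw]
  set s := p.roots.map fun z => 1 / (w - z)
  have hcard : s.card ≤ n := by
    rw [Multiset.card_map]; exact (card_roots' p).trans hdeg
  have hs : s.sum = n * (1 / (w - v)) := by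
    rw [← (IsAlgClosed.splits p).eval_derivative_div_eval_of_ne_zero hpw]
    field_simp
    linear_combination -h0
  have hmem : ∀ u ∈ s, ‖u + c‖ ≤ R := by
    intro u hu
    obtain ⟨r, hr, rfl⟩ := Multiset.mem_map.mp hu
    have hr' := im_root_nonpos hp hr
    refine (norm_inv_add_le_iff ?_ hw).mpr ?_
    · intro h
      have := congrArg Complex.im h
      simp at this
      linarith
    · simp [hr']
  have h1 := norm_multiset_sum_add_le hmem
  -- The `n - s.card` missing roots count as roots at infinity: they contribute `0`, a boundary
  -- point of the disc. Averaging puts `1 / (w - v)` in the disc, which forces `v.im ≤ 0`.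
  have h2 : ‖(n : ℂ) * (1 / (w - v) + c)‖ ≤ n * R := by
    calc ‖(n : ℂ) * (1 / (w - v) + c)‖
        = ‖(s.sum + s.card * c) + ((n - s.card : ℕ) : ℂ) * c‖ := by
          rw [hs, Nat.cast_sub hcard]; congr 1; ring
      _ ≤ s.card * R + ‖((n - s.card : ℕ) : ℂ) * c‖ := (norm_add_le _ _).trans (by gcongr)
      _ = n * R := by
          rw [norm_mul, hc, Complex.norm_natCast, Nat.cast_sub hcard]; ring
  rw [norm_mul, Complex.norm_natCast, mul_le_mul_iff_right₀ (by exact_mod_cast hn)] at h2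
  have := (norm_inv_add_le_iff hwv hw).mp h2
  simp at this
  linarith

/-- Gauss–Lucas, applied to roots in the convex closed lower half-plane. -/
theorem derivative_mem_stableUnivariate {p : ℂ[X]} (hp : p ∈ stableUnivariate)
    (h0 : derivative p ≠ 0) : derivative p ∈ stableUnivariate := by
  intro z hz hpz
  have hd : 0 < p.degree := by
    by_contra! h
    exact h0 (by rw [eq_C_of_degree_le_zero h, derivative_C])
  have hmem : z ∈ p.derivative.rootSet ℂ := by
    rw [mem_rootSet, coe_aeval_eq_eval]
    exact ⟨h0, hpz⟩
  have hsub : convexHull ℝ (p.rootSet ℂ) ⊆ {z : ℂ | z.im ≤ 0} := by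
    refine convexHull_min ?_ (convex_halfSpace_im_le 0)
    intro r hr
    rw [mem_rootSet, coe_aeval_eq_eval] at hr
    by_contra hlt
    exact hp r (not_le.mp hlt) hr.2
  exact absurd hz (not_lt.mpr (hsub (rootSet_derivative_subset_convexHull_rootSet hd hmem)))

/-- Growth of a stable polynomial compared with its value at a point of the upper half-plane. -/
theorem norm_eval_le_of_stable {p : ℂ[X]} (hp : p ∈ stableUnivariate) {D : ℕ}
    (hD : p.natDegree ≤ D) {z₀ : ℂ} (hz₀ : 0 < z₀.im) (z : ℂ) :
    ‖p.eval z‖ ≤ (1 + ‖z - z₀‖ / z₀.im) ^ D * ‖p.eval z₀‖ := by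
  set K : ℝ := 1 + ‖z - z₀‖ / z₀.im
  have hK : 1 ≤ K := by
    have : 0 ≤ ‖z - z₀‖ / z₀.im := by positivity
    linarith
  have hroot : ∀ r ∈ p.roots, ‖z - r‖ ≤ K * ‖z₀ - r‖ := by
    intro r hr
    have hr' := im_root_nonpos hp hr
    have h1 : z₀.im ≤ ‖z₀ - r‖ := by
      have := Complex.abs_im_le_norm (z₀ - r)
      rw [Complex.sub_im] at this
      linarith [le_abs_self (z₀.im - r.im)]
    have h2 : ‖z - r‖ ≤ ‖z - z₀‖ + ‖z₀ - r‖ := norm_sub_le_norm_sub_add_norm_sub _ _ _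
    have h3 : ‖z - z₀‖ ≤ ‖z - z₀‖ / z₀.im * ‖z₀ - r‖ := by
      calc ‖z - z₀‖ = ‖z - z₀‖ / z₀.im * z₀.im := by field_simp
        _ ≤ _ := by gcongr
    calc ‖z - r‖ ≤ _ := h2
      _ ≤ ‖z - z₀‖ / z₀.im * ‖z₀ - r‖ + ‖z₀ - r‖ := by linarith
      _ = _ := by simp only [K]; ring
  have hprod : ∀ s : Multiset ℂ, (∀ r ∈ s, ‖z - r‖ ≤ K * ‖z₀ - r‖) →
      ‖(s.map (z - ·)).prod‖ ≤ K ^ s.card * ‖(s.map (z₀ - ·)).prod‖ := by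
    intro s
    induction s using Multiset.induction_on with
    | empty => simp
    | cons a s ih =>
      intro h
      simp only [Multiset.map_cons, Multiset.prod_cons, Multiset.card_cons, norm_mul]
      calc _ ≤ (K * ‖z₀ - a‖) * (K ^ s.card * ‖(s.map (z₀ - ·)).prod‖) := by
            gcongr
            · exact h a (Multiset.mem_cons_self a s)
            · exact ih fun r hr => h r (Multiset.mem_cons_of_mem hr)
        _ = _ := by ring
  rw [(IsAlgClosed.splits p).eval_eq_prod_roots z, (IsAlgClosed.splits p).eval_eq_prod_roots z₀,
    norm_mul, norm_mul]
  calc _ ≤ ‖p.leadingCoeff‖ * (K ^ p.roots.card * ‖(p.roots.map (z₀ - ·)).prod‖) := by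
        gcongr
        exact hprod _ hroot
    _ ≤ ‖p.leadingCoeff‖ * (K ^ D * ‖(p.roots.map (z₀ - ·)).prod‖) := by
        gcongr
        exact (card_roots' p).trans hD
    _ = _ := by ring

/-- Hurwitz' theorem for polynomials of bounded degree in the upper half-plane. -/
theorem mem_stableUnivariate_union_zero_of_tendsto {ι : Type*} {l : Filter ι} [l.NeBot]
    {q : ι → ℂ[X]} {p : ℂ[X]} {D : ℕ} (hq : ∀ᶠ i in l, q i ∈ stableUnivariate)
    (hD : ∀ i, (q i).natDegree ≤ D)
    (hlim : ∀ z, Tendsto (fun i => (q i).eval z) l (𝓝 (p.eval z))) :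
    p ∈ stableUnivariate ∪ {0} := by
  by_cases hp : p ∈ stableUnivariate
  · exact Or.inl hp
  refine Or.inr ?_
  simp only [stableUnivariate, Set.mem_ofPred_eq, not_forall, not_not] at hp
  obtain ⟨z₀, hz₀, h0⟩ := hp
  refine Polynomial.funext fun z => ?_
  -- The growth bound is uniform in `i`, so it survives the limit; the zero at `z₀` then spreads to
  -- every `z`.
  have h1 : ‖p.eval z‖ ≤ (1 + ‖z - z₀‖ / z₀.im) ^ D * ‖p.eval z₀‖ :=
    le_of_tendsto_of_tendsto (hlim z).norm ((hlim z₀).norm.const_mul _)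
      (hq.mono fun i hi => norm_eval_le_of_stable hi (hD i) hz₀ z)
  rw [h0, norm_zero, mul_zero] at h1
  simpa using h1

/-! ### The symbol of a linear functional -/

/-- The polynomial `w ↦ L ((z + w) ^ n)`. -/
def functionalSymbol (L : ℂ[X] →ₗ[ℂ] ℂ) (n : ℕ) : ℂ[X] :=
  ∑ k ∈ Finset.range (n + 1), monomial (n - k) (L (X ^ k) * n.choose k)

theorem eval_functionalSymbol (L : ℂ[X] →ₗ[ℂ] ℂ) (n : ℕ) (w : ℂ) :
    (functionalSymbol L n).eval w = L ((X + C w) ^ n) := by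
  rw [functionalSymbol, eval_finsetSum, add_pow, map_sum]
  refine Finset.sum_congr rfl fun k _ => ?_
  have : (X ^ k * C w ^ (n - k) * (n.choose k : ℂ[X]) : ℂ[X]) =
      (w ^ (n - k) * n.choose k) • X ^ k := by
    rw [smul_eq_C_mul]; simp; ring
  rw [this, map_smul, eval_monomial, smul_eq_mul]
  ring

theorem natDegree_functionalSymbol_le (L : ℂ[X] →ₗ[ℂ] ℂ) (n : ℕ) :
    (functionalSymbol L n).natDegree ≤ n :=
  natDegree_sum_le_of_forall_le _ _ fun _ _ => (natDegree_monomial_le _).trans (Nat.sub_le _ _)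

theorem coeff_functionalSymbol (L : ℂ[X] →ₗ[ℂ] ℂ) {n k : ℕ} (hk : k ≤ n) :
    (functionalSymbol L n).coeff (n - k) = L (X ^ k) * n.choose k := by
  rw [functionalSymbol, finsetSum_coeff, Finset.sum_eq_single k]
  · simp
  · intro j hj hjk
    rw [coeff_monomial, if_neg]
    have := Finset.mem_range.mp hj
    omega
  · intro h
    exact absurd (Finset.mem_range.mpr (by omega)) h

/-- The Appell property, inherited from differentiating `(z + w) ^ (n + 1)` in `w`. -/
theorem derivative_functionalSymbol (L : ℂ[X] →ₗ[ℂ] ℂ) (n : ℕ) :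
    derivative (functionalSymbol L (n + 1)) = C ((n : ℂ) + 1) * functionalSymbol L n := by
  rw [functionalSymbol, Finset.sum_range_succ, derivative_add, derivative_sum, functionalSymbol,
    Finset.mul_sum]
  simp only [Nat.sub_self, monomial_zero_left, derivative_C, add_zero]
  refine Finset.sum_congr rfl fun k hk => ?_
  have hk' : k ≤ n := by have := Finset.mem_range.mp hk; omega
  rw [derivative_monomial, C_mul_monomial, show n + 1 - k - 1 = n - k by omega]
  congr 1
  have h := Nat.choose_mul_succ_eq n k
  have h' : (n.choose k : ℂ) * (n + 1) = (n + 1).choose k * ((n + 1 - k : ℕ) : ℂ) := by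
    exact_mod_cast h
  linear_combination -L (X ^ k) * h'

theorem linearMap_apply_eq_sum {M : Type*} [AddCommMonoid M] [Module ℂ M] (L : ℂ[X] →ₗ[ℂ] M)
    {f : ℂ[X]} {n : ℕ} (hf : f.natDegree ≤ n) :
    L f = ∑ k ∈ Finset.range (n + 1), f.coeff k • L (X ^ k) := by
  conv_lhs => rw [f.as_sum_range_C_mul_X_pow' (Nat.lt_succ_of_le hf)]
  simp [← smul_eq_C_mul]

/-- A form of Grace's theorem for the upper half-plane. -/
theorem functional_prod_ne_zero (s : Multiset ℂ) (L : ℂ[X] →ₗ[ℂ] ℂ)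
    (hL : ∀ w : ℂ, 0 < w.im → L ((X + C w) ^ s.card) ≠ 0) (hs : ∀ w ∈ s, 0 < w.im) :
    L (s.map fun w => X + C w).prod ≠ 0 := by
  induction s using Multiset.induction_on generalizing L with
  | empty => simpa using hL Complex.I (by simp)
  | cons v s ih =>
    have hv : 0 < v.im := hs v (Multiset.mem_cons_self v s)
    rw [Multiset.card_cons] at hL
    have key := ih (L ∘ₗ LinearMap.mulLeft ℂ (X + C v)) ?_
      fun w hw => hs w (Multiset.mem_cons_of_mem hw)
    · simpa using key
    intro w hw h0
    have hst : functionalSymbol L (s.card + 1) ∈ stableUnivariate := by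
      intro u hu
      rw [eval_functionalSymbol]
      exact hL u hu
    refine polar_derivative_ne_zero hst (natDegree_functionalSymbol_le _ _) (Nat.succ_pos _)
      hv hw ?_
    rw [derivative_functionalSymbol, eval_mul, eval_C, eval_functionalSymbol,
      eval_functionalSymbol]
    -- Up to the factor `s.card + 1`, `L` of this product is the polar derivative at `w`, with pole
    -- `v`, of the symbol of degree `s.card + 1`.
    have hsplit : (X + C v) * (X + C w) ^ s.card =
        (X + C w) ^ (s.card + 1) + (v - w) • (X + C w) ^ s.card := by
      rw [smul_eq_C_mul, C_sub]; ring
    simp only [LinearMap.comp_apply, LinearMap.mulLeft_apply] at h0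
    rw [hsplit, map_add, map_smul, smul_eq_mul] at h0
    push_cast
    linear_combination ((s.card : ℂ) + 1) * h0

theorem functional_ne_zero_of_strictly_stable {L : ℂ[X] →ₗ[ℂ] ℂ} {f : ℂ[X]}
    (hL : ∀ w : ℂ, 0 < w.im → L ((X + C w) ^ f.natDegree) ≠ 0)
    (hf : ∀ z : ℂ, 0 ≤ z.im → f.eval z ≠ 0) : L f ≠ 0 := by
  have hf0 : f ≠ 0 := by
    rintro rfl
    exact hf 0 (by simp) (by simp)
  have hsplit := IsAlgClosed.splits f
  rw [hsplit.eq_prod_roots, ← smul_eq_C_mul, map_smul]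
  refine smul_ne_zero (leadingCoeff_ne_zero.mpr hf0) ?_
  have hroots : (f.roots.map fun r => X - C r) =
      (f.roots.map Neg.neg).map fun w => X + C w := by
    simp [Multiset.map_map, sub_eq_add_neg]
  rw [hroots]
  refine functional_prod_ne_zero _ L ?_ ?_
  · rwa [Multiset.card_map, ← hsplit.natDegree_eq_card_roots]
  · intro w hw
    obtain ⟨r, hr, rfl⟩ := Multiset.mem_map.mp hw
    by_contra! h
    exact hf r (by simpa using h) (isRoot_of_mem_roots hr)

/-! ### Linear operators -/

theorem exists_natDegree_apply_le (T : ℂ[X] →ₗ[ℂ] ℂ[X]) (n : ℕ) :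
    ∃ D, ∀ f : ℂ[X], f.natDegree ≤ n → (T f).natDegree ≤ D := by
  refine ⟨(Finset.range (n + 1)).sup fun k => (T (X ^ k)).natDegree, fun f hf => ?_⟩
  rw [linearMap_apply_eq_sum T hf]
  exact natDegree_sum_le_of_forall_le _ _ fun k hk => (natDegree_smul_le _ _).trans
    (Finset.le_sup (f := fun k => (T (X ^ k)).natDegree) hk)

/-- The functional `f ↦ T f (z)`. -/
def evalFunctional (T : ℂ[X] →ₗ[ℂ] ℂ[X]) (z : ℂ) : ℂ[X] →ₗ[ℂ] ℂ :=
  leval z ∘ₗ T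

theorem evalFunctional_apply (T : ℂ[X] →ₗ[ℂ] ℂ[X]) (z : ℂ) (f : ℂ[X]) :
    evalFunctional T z f = (T f).eval z := rfl

/-- Translating `f` by `t * I` pushes its roots strictly below the real axis, where Grace applies;
Hurwitz handles `t → 0⁺`. -/
theorem apply_mem_of_symbol_ne_zero {T : ℂ[X] →ₗ[ℂ] ℂ[X]} {f : ℂ[X]}
    (hf : f ∈ stableUnivariate)
    (hT : ∀ z w : ℂ, 0 < z.im → 0 < w.im → (T ((X + C w) ^ f.natDegree)).eval z ≠ 0) :
    T f ∈ stableUnivariate ∪ {0} := by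
  obtain ⟨D, hD⟩ := exists_natDegree_apply_le T f.natDegree
  have hdeg : ∀ t : ℝ, (taylor (t * Complex.I) f).natDegree = f.natDegree :=
    fun t => natDegree_taylor f _
  refine mem_stableUnivariate_union_zero_of_tendsto (l := 𝓝[>] (0 : ℝ))
    (q := fun t => T (taylor (t * Complex.I) f)) (D := D) ?_ (fun t => hD _ (hdeg t).le) ?_
  · filter_upwards [self_mem_nhdsWithin] with t ht z hz
    refine functional_ne_zero_of_strictly_stable (L := evalFunctional T z) ?_ ?_
    · intro w hw
      rw [hdeg]
      exact hT z w hz hw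
    · intro u hu
      rw [taylor_eval]
      refine hf _ ?_
      have : 0 < t := ht
      simp
      linarith
  · intro z
    have hcont : Continuous fun t : ℝ => (T (taylor (t * Complex.I) f)).eval z := by
      have : (fun t : ℝ => (T (taylor (t * Complex.I) f)).eval z) = fun t : ℝ =>
          ∑ k ∈ Finset.range (f.natDegree + 1),
            (hasseDeriv k f).eval (t * Complex.I) • evalFunctional T z (X ^ k) := by
        funext t
        rw [← evalFunctional_apply, linearMap_apply_eq_sum _ (hdeg t).le]
        simp only [taylor_coeff]
      rw [this]
      fun_prop
    have h := (hcont.tendsto 0).mono_left (nhdsWithin_le_nhds (s := Set.Ioi 0))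
    simpa using h

/-- The coefficients of the symbol are the values on `X ^ k`, `k ≤ n`, times nonzero binomials. -/
theorem apply_eq_zero_of_symbol_eq_zero {T : ℂ[X] →ₗ[ℂ] ℂ[X]} {n : ℕ}
    (hT : ∀ w : ℂ, T ((X + C w) ^ n) = 0) {f : ℂ[X]} (hf : f.natDegree ≤ n) : T f = 0 := by
  refine Polynomial.funext fun z => ?_
  have h0 : functionalSymbol (evalFunctional T z) n = 0 := by
    refine Polynomial.funext fun w => ?_
    rw [eval_functionalSymbol, evalFunctional_apply, hT]
    simp
  rw [← evalFunctional_apply, linearMap_apply_eq_sum _ hf, eval_zero]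
  refine Finset.sum_eq_zero fun k hk => ?_
  have hk' : k ≤ n := by have := Finset.mem_range.mp hk; omega
  have h := coeff_functionalSymbol (evalFunctional T z) hk'
  rw [h0, coeff_zero, eq_comm, mul_eq_zero] at h
  rcases h with h | h
  · rw [h, smul_zero]
  · exact absurd (Nat.cast_eq_zero.mp h) (Nat.choose_pos hk').ne'

/-- A polynomial of degree at most `n` is a small perturbation of `(z + w) ^ n`. -/
theorem exists_pow_add_smul_stable {w : ℂ} (hw : 0 < w.im) {n : ℕ} {f : ℂ[X]}
    (hf : f.natDegree ≤ n) :
    ∃ ε : ℂ, ε ≠ 0 ∧ (X + C w) ^ n + ε • f ∈ stableUnivariate := by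
  set g := taylor (-w) f
  have hg : g.natDegree ≤ n := (natDegree_taylor f _).trans_le hf
  -- With `u = z + w`, `f` is `g` in powers of `u`, and `‖u‖ ≥ w.im` gives `‖u‖ ^ k ≤ ‖u‖ ^ n / w.im
  -- ^ (n - k)`. Hence `‖f‖ ≤ K * ‖u‖ ^ n`, and `ε = 1 / (K + 1)` suffices.
  set K : ℝ := ∑ k ∈ Finset.range (n + 1), ‖g.coeff k‖ / w.im ^ (n - k)
  have hK : 0 ≤ K := Finset.sum_nonneg fun k _ => by positivity
  have hK1 : ((K + 1 : ℝ) : ℂ) ≠ 0 := by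
    have : K + 1 ≠ 0 := by positivity
    exact_mod_cast this
  refine ⟨((K + 1 : ℝ) : ℂ)⁻¹, ?_, ?_⟩
  · exact inv_ne_zero hK1
  intro z hz h0
  have hu : w.im ≤ ‖z + w‖ := by
    have := (le_abs_self _).trans (Complex.abs_im_le_norm (z + w))
    rw [Complex.add_im] at this
    linarith
  have hupos : 0 < ‖z + w‖ := hw.trans_le hu
  have hfz : f.eval z = g.eval (z + w) := by simp [g, taylor_eval]
  have hbound : ‖f.eval z‖ ≤ K * ‖z + w‖ ^ n := by
    rw [hfz, eval_eq_sum_range' (Nat.lt_succ_of_le hg), Finset.sum_mul]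
    refine (norm_sum_le _ _).trans (Finset.sum_le_sum fun k hk => ?_)
    have hk' : k ≤ n := by have := Finset.mem_range.mp hk; omega
    rw [norm_mul, norm_pow, div_mul_eq_mul_div, le_div_iff₀ (by positivity), mul_assoc]
    gcongr
    calc ‖z + w‖ ^ k * w.im ^ (n - k) ≤ ‖z + w‖ ^ k * ‖z + w‖ ^ (n - k) := by gcongr
      _ = ‖z + w‖ ^ n := by rw [← pow_add, Nat.add_sub_cancel' hk']
  simp only [eval_add, eval_pow, eval_X, eval_C, eval_smul, smul_eq_mul] at h0
  have h1 : f.eval z = -(((K + 1 : ℝ) : ℂ) * (z + w) ^ n) := by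
    field_simp at h0
    linear_combination h0
  have h2 : ‖f.eval z‖ = (K + 1) * ‖z + w‖ ^ n := by
    rw [h1, norm_neg, norm_mul, norm_pow, Complex.norm_real, Real.norm_of_nonneg (by positivity)]
  have h3 : 0 < ‖z + w‖ ^ n := by positivity
  linarith

theorem PreservesStability.apply_mem {T : ℂ[X] →ₗ[ℂ] ℂ[X]} (hT : PreservesStability T) {f : ℂ[X]}
    (hf : f ∈ stableUnivariate) : T f ∈ stableUnivariate ∪ {0} :=
  hT (Set.mem_image_of_mem T hf)

/-- `T` kills the main term of the stable perturbation, leaving `ε • T f`; `f` itself need not be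
stable. -/
theorem PreservesStability.apply_mem_of_symbol_eq_zero {T : ℂ[X] →ₗ[ℂ] ℂ[X]}
    (hT : PreservesStability T) {w : ℂ} (hw : 0 < w.im) {n : ℕ} (h0 : T ((X + C w) ^ n) = 0)
    {f : ℂ[X]} (hf : f.natDegree ≤ n) : T f ∈ stableUnivariate ∪ {0} := by
  obtain ⟨ε, hε, hst⟩ := exists_pow_add_smul_stable hw hf
  have h := hT.apply_mem hst
  rw [map_add, h0, zero_add, map_smul] at h
  rcases h with h | h
  · refine Or.inl fun z hz hz0 => h z hz ?_
    rw [eval_smul, hz0, smul_zero]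
  · exact Or.inr ((smul_eq_zero.mp h).resolve_left hε)

/-- A linear space of stable polynomials and zero is at most one-dimensional. -/
theorem exists_smul_of_forall_apply_mem {T : ℂ[X] →ₗ[ℂ] ℂ[X]}
    (hT : ∀ f, T f ∈ stableUnivariate ∪ {0}) :
    ∃ (α : ℂ[X] →ₗ[ℂ] ℂ) (P : ℂ[X]), P ∈ stableUnivariate ∧ ∀ f, T f = α f • P := by
  by_cases h : ∃ g, T g ≠ 0
  · obtain ⟨g, hg⟩ := h
    have hgs : T g ∈ stableUnivariate := (hT g).resolve_right hg
    have hI : (T g).eval Complex.I ≠ 0 := hgs _ (by simp)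
    refine ⟨((T g).eval Complex.I)⁻¹ • evalFunctional T Complex.I, T g, hgs, fun f => ?_⟩
    rw [LinearMap.smul_apply, evalFunctional_apply, smul_eq_mul, ← sub_eq_zero, ← map_smul,
      ← map_sub]
    -- The combination of `T f` and `T g` is built to vanish at `I`, so it is not stable and must be
    -- zero.
    refine (hT _).resolve_left fun hst => hst Complex.I (by simp) ?_
    rw [map_sub, map_smul, eval_sub, eval_smul, smul_eq_mul]
    field_simp
    ring
  · push Not at h
    refine ⟨0, 1, fun z _ => by simp, fun f => ?_⟩
    rw [h f, LinearMap.zero_apply, zero_smul]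

theorem rank_range_le_one_of_eq_smul {T : ℂ[X] →ₗ[ℂ] ℂ[X]} {α : ℂ[X] →ₗ[ℂ] ℂ} {P : ℂ[X]}
    (h : ∀ f, T f = α f • P) : Module.rank ℂ (LinearMap.range T) ≤ 1 := by
  have hle : LinearMap.range T ≤ Submodule.span ℂ {P} := by
    rintro _ ⟨f, rfl⟩
    rw [h f]
    exact Submodule.smul_mem _ _ (Submodule.mem_span_singleton_self P)
  refine (Submodule.rank_mono hle).trans ((rank_span_le _).trans ?_)
  simp

theorem preservesStability_of_eq_smul {T : ℂ[X] →ₗ[ℂ] ℂ[X]} {α : ℂ[X] →ₗ[ℂ] ℂ} {P : ℂ[X]}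
    (hP : P ∈ stableUnivariate) (h : ∀ f, T f = α f • P) : PreservesStability T := by
  rintro _ ⟨f, _, rfl⟩
  rw [h f]
  by_cases hα : α f = 0
  · right
    simp [hα]
  · left
    intro z hz
    rw [eval_smul]
    exact smul_ne_zero hα (hP z hz)

/-! ### The bivariate symbol -/

theorem eval_aeval_X_zero (z : Fin 2 → ℂ) (p : ℂ[X]) :
    MvPolynomial.eval z (aeval (MvPolynomial.X (0 : Fin 2)) p) = p.eval (z 0) := by
  rw [← MvPolynomial.coe_aeval_eq_eval, RingHom.coe_coe, ← Polynomial.aeval_algHom_apply]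
  simp

theorem eval_extendBivariate_pow (T : ℂ[X] →ₗ[ℂ] ℂ[X]) (n : ℕ) (z : Fin 2 → ℂ) :
    MvPolynomial.eval z (extendBivariate T ((MvPolynomial.X 0 + MvPolynomial.X 1) ^ n)) =
      (T ((X + C (z 1)) ^ n)).eval (z 0) := by
  rw [← evalFunctional_apply, ← eval_functionalSymbol, functionalSymbol, eval_finsetSum,
    add_pow, map_sum, map_sum]
  refine Finset.sum_congr rfl fun k _ => ?_
  have h : (MvPolynomial.X 0 ^ k * MvPolynomial.X 1 ^ (n - k) *
      (n.choose k : MvPolynomial (Fin 2) ℂ)) =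
      (n.choose k : ℂ) • (MvPolynomial.X 0 ^ k * MvPolynomial.X 1 ^ (n - k)) := by
    rw [MvPolynomial.smul_eq_C_mul, map_natCast, mul_comm]
  rw [h, map_smul, extendBivariate_apply, MvPolynomial.smul_eval, map_mul, eval_aeval_X_zero,
    map_pow (MvPolynomial.eval z), MvPolynomial.eval_X, eval_monomial, evalFunctional_apply]
  ring

theorem symbol_mem_iff (T : ℂ[X] →ₗ[ℂ] ℂ[X]) (n : ℕ) :
    extendBivariate T ((MvPolynomial.X 0 + MvPolynomial.X 1) ^ n) ∈ stablePolys 2 ∪ {0} ↔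
      (∀ z w : ℂ, 0 < z.im → 0 < w.im → (T ((X + C w) ^ n)).eval z ≠ 0) ∨
        ∀ w : ℂ, T ((X + C w) ^ n) = 0 := by
  refine or_congr ⟨fun h z w hz hw => ?_, fun h z hz => ?_⟩ ⟨fun h w => ?_, fun h => ?_⟩
  · have := h ![z, w] (by simp [Fin.forall_fin_two, hz, hw])
    rwa [eval_extendBivariate_pow] at this
  · rw [eval_extendBivariate_pow]
    exact h _ _ (hz 0) (hz 1)
  · refine Polynomial.funext fun z => ?_
    have := eval_extendBivariate_pow T n ![z, w]
    rw [Set.mem_singleton_iff.mp h] at this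
    simpa using this.symm
  · refine MvPolynomial.funext fun z => ?_
    rw [eval_extendBivariate_pow, h]
    simp

theorem pow_X_add_C_mem_stableUnivariate {w : ℂ} (hw : 0 < w.im) (n : ℕ) :
    (X + C w) ^ n ∈ stableUnivariate := by
  intro z hz
  rw [eval_pow, eval_add, eval_X, eval_C]
  refine pow_ne_zero n fun h => ?_
  have := congrArg Complex.im h
  rw [Complex.add_im, Complex.zero_im] at this
  linarith

/-- For fixed `z`, Gauss–Lucas makes the lower symbol stable in `w` or identically zero. A zero at
`(z₀, w₀)` makes `T ((X + C w₀) ^ n)` unstable, hence zero; so `w₀` is a zero for every `z`, and the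
whole symbol vanishes. -/
theorem PreservesStability.symbol_descend {T : ℂ[X] →ₗ[ℂ] ℂ[X]} (hT : PreservesStability T) {n : ℕ}
    (h : (∀ z w : ℂ, 0 < z.im → 0 < w.im → (T ((X + C w) ^ (n + 1))).eval z ≠ 0) ∨
        ∀ w : ℂ, T ((X + C w) ^ (n + 1)) = 0) :
    (∀ z w : ℂ, 0 < z.im → 0 < w.im → (T ((X + C w) ^ n)).eval z ≠ 0) ∨
        ∀ w : ℂ, T ((X + C w) ^ n) = 0 := by
  rcases h with h | h
  · by_contra! hcon
    obtain ⟨⟨z₀, w₀, hz₀, hw₀, h0⟩, w₁, hw₁⟩ := hcon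
    have hderiv (z : ℂ) (hz : 0 < z.im) (w : ℂ) (hw : 0 < w.im)
        (hzw : (T ((X + C w) ^ n)).eval z = 0) :
        functionalSymbol (evalFunctional T z) n = 0 := by
      have hst : functionalSymbol (evalFunctional T z) (n + 1) ∈ stableUnivariate := by
        intro u hu
        rw [eval_functionalSymbol]
        exact h z u hz hu
      have hn : C ((n : ℂ) + 1) ≠ 0 := C_ne_zero.mpr (by exact_mod_cast Nat.succ_ne_zero n)
      by_contra hne
      have hd := derivative_functionalSymbol (evalFunctional T z) n
      refine derivative_mem_stableUnivariate hst (hd ▸ mul_ne_zero hn hne) w hw ?_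
      rw [hd, eval_mul, eval_functionalSymbol, evalFunctional_apply, hzw, mul_zero]
    have hw₀T : T ((X + C w₀) ^ n) = 0 :=
      (hT.apply_mem (pow_X_add_C_mem_stableUnivariate hw₀ n)).resolve_left
        fun hst => hst z₀ hz₀ h0
    have hline (z : ℂ) (hz : 0 < z.im) : (T ((X + C w₁) ^ n)).eval z = 0 := by
      rw [← evalFunctional_apply, ← eval_functionalSymbol,
        hderiv z hz w₀ hw₀ (by rw [hw₀T, eval_zero]), eval_zero]
    refine hw₁ (eq_zero_of_infinite_isRoot _ (Set.Infinite.mono (s := {z : ℂ | 0 < z.im}) hline ?_))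
    have hinj : Function.Injective fun k : ℕ => ((k : ℂ) + Complex.I) := fun a b hab => by
      simpa using hab
    refine (Set.infinite_range_of_injective hinj).mono ?_
    rintro _ ⟨k, rfl⟩
    simp
  · exact Or.inr fun w => apply_eq_zero_of_symbol_eq_zero h
      ((natDegree_pow_X_add_C n w).le.trans n.le_succ)

/-- Otherwise preservation makes every `T ((X + C w) ^ N)` with `0 < w.im` stable, and descent from
`N` to `n` contradicts `hn`. -/
theorem PreservesStability.exists_symbol_eq_zero {T : ℂ[X] →ₗ[ℂ] ℂ[X]}
    (hT : PreservesStability T) {n : ℕ}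
    (hn : ¬((∀ z w : ℂ, 0 < z.im → 0 < w.im → (T ((X + C w) ^ n)).eval z ≠ 0) ∨
        ∀ w : ℂ, T ((X + C w) ^ n) = 0)) {N : ℕ} (hN : n ≤ N) :
    ∃ w : ℂ, 0 < w.im ∧ T ((X + C w) ^ N) = 0 := by
  by_contra! hcon
  refine hn (Nat.decreasingInduction' (n := N) (P := fun k =>
    (∀ z w : ℂ, 0 < z.im → 0 < w.im → (T ((X + C w) ^ k)).eval z ≠ 0) ∨
      ∀ w : ℂ, T ((X + C w) ^ k) = 0) (fun _ _ _ => hT.symbol_descend) hN (Or.inl ?_))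
  intro z w hz hw
  exact ((hT.apply_mem (pow_X_add_C_mem_stableUnivariate hw N)).resolve_right (hcon w hw)) z hz

end StabilityPreservers

end

theorem corollary2p7 (T : Polynomial ℂ →ₗ[ℂ] Polynomial ℂ) :
    StabilityPreservers.PreservesStability T ↔
      ((Module.rank ℂ (LinearMap.range T) ≤ 1 ∧
          ∃ (α : Polynomial ℂ →ₗ[ℂ] ℂ) (P : Polynomial ℂ),
            P ∈ StabilityPreservers.stableUnivariate ∧
              ∀ f : Polynomial ℂ, T f = α f • P) ∨
        ∀ n : ℕ,
          StabilityPreservers.extendBivariate T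
              ((MvPolynomial.X 0 + MvPolynomial.X 1) ^ n) ∈
            StabilityPreservers.stablePolys 2 ∪ {0}) := by
  open StabilityPreservers in
  constructor
  · intro hT
    by_cases hb : ∀ n : ℕ, extendBivariate T
        ((MvPolynomial.X 0 + MvPolynomial.X 1) ^ n) ∈ stablePolys 2 ∪ {0}
    · exact Or.inr hb
    left
    obtain ⟨n, hn⟩ := not_forall.mp hb
    rw [symbol_mem_iff] at hn
    have hrange : ∀ f, T f ∈ stableUnivariate ∪ {0} := fun f => by
      -- The maximum is both at least the bad index `n` and large enough for `f` to be a
      -- perturbation.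
      obtain ⟨w, hw, h0⟩ := hT.exists_symbol_eq_zero hn (le_max_left n f.natDegree)
      exact hT.apply_mem_of_symbol_eq_zero hw h0 (le_max_right n f.natDegree)
    obtain ⟨α, P, hP, h⟩ := exists_smul_of_forall_apply_mem hrange
    exact ⟨rank_range_le_one_of_eq_smul h, α, P, hP, h⟩
  · rintro (⟨-, α, P, hP, h⟩ | h)
    · exact preservesStability_of_eq_smul hP h
    · rintro _ ⟨f, hf, rfl⟩
      rcases (symbol_mem_iff T f.natDegree).mp (h f.natDegree) with h | h
      · exact apply_mem_of_symbol_ne_zero hf h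
      · exact Or.inr (apply_eq_zero_of_symbol_eq_zero h le_rfl)
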